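/- Let $\mathbb{K}$ be a field of characteristic zero and $S=\mathbb{K}[x_1,\dots,x_\ell]$ the polynomial ring on $V=\mathbb{K}^\ell$. A (central) $\ell$-arrangement $\mathscr{A}$ is a finite set of hyperplanes of $V$ through the origin; choosing for each $H\in\mathscr{A}$ a linear form $\alpha_H$ with kernel $H$, the product $Q=\prod_{H\in\mathscr{A}}\alpha_H\in S$ is called a defining polynomial of $\mathscr{A}$ (it is unique up to a nonzero constant). For $m\ge 0$ let $D^{(m)}(S)=\bigoplus_{a_1+\cdots+a_\ell=m}S\,\partial_1^{a_1}\cdots\partial_\ell^{a_\ell}\subseteq\operatorname{End}_{\mathbb{K}}(S)$, and let $$D^{(m)}(\mathscr{A})=\{\theta\in D^{(m)}(S)\mid \theta(QS)\subseteq QS\},$$ an $S$-submodule for multiplication by polynomials from the left. The arrangement $\mathscr{A}$ is called $m$-free if $D^{(m)}(\mathscr{A})$ is a free $S$-module. The product of arrangements $\mathscr{A}_1$ in $V_1$ and $\mathscr{A}_2$ in $V_2$ is the arrangement $\{H\oplus V_2\mid H\in\mathscr{A}_1\}\cup\{V_1\oplus H\mid H\in\mathscr{A}_2\}$ in $V_1\oplus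 V_2$. The arrangement $\mathscr{A}$ is called reducible if a linear isomorphism $V\cong V_1\oplus V_2$ with $\dim V_1>0$ and $\dim V_2>0$ carries it to such a product, and irreducible otherwise. **Proposition.** The $4$-arrangement over $\mathbb{K}$ with defining polynomial $$Q=xyzw(x+y+z)(x+y+z+w)\in\mathbb{K}[x,y,z,w]$$ is irreducible, and it is not $m$-free for any $m\ge 1$. In particular, the following question of Holm has a negative answer over $\mathbb{K}$, even when restricted to irreducible arrangements: is every arrangement $\mathscr{A}$ $m$-free for all sufficiently large $m$ (depending on $\mathscr{A}$)? -/

import Mathlib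

open MvPolynomial

noncomputable section

/-- A central hyperplane arrangement in the `K`-vector space `V`: a finite set of hyperplanes
through the origin, i.e. of kernels of nonzero linear forms. -/
structure CentralArrangement (K V : Type*) [Field K] [AddCommGroup V] [Module K V] where
  hyperplanes : Set (Submodule K V)
  finite : hyperplanes.Finite
  isHyperplane : ∀ H ∈ hyperplanes, ∃ α : Module.Dual K V, α ≠ 0 ∧ LinearMap.ker α = H

/-- The linear form `α` on `K ^ ℓ`, seen as an element of `S = K[x_1, …, x_ℓ]`. -/
def linearFormPoly {K : Type*} [Field K] {ℓ : ℕ} (α : Module.Dual K (Fin ℓ → K)) :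
    MvPolynomial (Fin ℓ) K :=
  ∑ i, C (α (Pi.single i 1)) * X i

/-- The monomial operator `∂_1 ^ a_1 ⋯ ∂_ℓ ^ a_ℓ` in `End_K(S)`. -/
def partialOp (K : Type*) [Field K] {ℓ : ℕ} (a : Fin ℓ → ℕ) :
    Module.End K (MvPolynomial (Fin ℓ) K) :=
  (List.ofFn fun i => (pderiv i).toLinearMap ^ a i).prod

/-- `D^(m)(S) = ∑_{|a| = m} S ∂^a` as an `S`-submodule of `End_K(S)`, where `S` acts on `End_K(S)`
by `(f • θ) p = f * θ p`. -/
def diffOpsOfOrder (K : Type*) [Field K] (ℓ m : ℕ) :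
    Submodule (MvPolynomial (Fin ℓ) K) (Module.End K (MvPolynomial (Fin ℓ) K)) :=
  Submodule.span _ {θ | ∃ a : Fin ℓ → ℕ, ∑ i, a i = m ∧ θ = partialOp K a}

/-- `D^(m)(I) = {θ ∈ D^(m)(S) | θ(I) ⊆ I}` for an ideal `I` of `S`. -/
def diffOpsPreserving {K : Type*} [Field K] {ℓ : ℕ} (m : ℕ) (I : Ideal (MvPolynomial (Fin ℓ) K)) :
    Submodule (MvPolynomial (Fin ℓ) K) (Module.End K (MvPolynomial (Fin ℓ) K)) where
  carrier := {θ | θ ∈ diffOpsOfOrder K ℓ m ∧ ∀ f ∈ I, θ f ∈ I}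
  add_mem' := fun h₁ h₂ =>
    ⟨add_mem h₁.1 h₂.1, fun f hf => add_mem (h₁.2 f hf) (h₂.2 f hf)⟩
  zero_mem' := ⟨zero_mem _, fun _ _ => zero_mem I⟩
  smul_mem' := fun c _ h =>
    ⟨Submodule.smul_mem _ c h.1, fun f hf => I.mul_mem_left c (h.2 f hf)⟩

namespace CentralArrangement

/-- `Q` is a defining polynomial of `A`: a product `∏_{H ∈ A} α_H` of linear forms with
`ker α_H = H`. -/
def IsDefiningPolynomial {K : Type*} [Field K] {ℓ : ℕ} (A : CentralArrangement K (Fin ℓ → K))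
    (Q : MvPolynomial (Fin ℓ) K) : Prop :=
  ∃ α : Submodule K (Fin ℓ → K) → Module.Dual K (Fin ℓ → K),
    (∀ H ∈ A.hyperplanes, LinearMap.ker (α H) = H) ∧
      Q = ∏ H ∈ A.finite.toFinset, linearFormPoly (α H)

theorem exists_isDefiningPolynomial {K : Type*} [Field K] {ℓ : ℕ}
    (A : CentralArrangement K (Fin ℓ → K)) : ∃ Q, A.IsDefiningPolynomial Q := by
  choose! α hα using A.isHyperplane
  exact ⟨_, α, fun H hH => (hα H hH).2, rfl⟩

/-- A defining polynomial `Q(A)`, which is unique up to a nonzero constant. -/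
def definingPolynomial {K : Type*} [Field K] {ℓ : ℕ} (A : CentralArrangement K (Fin ℓ → K)) :
    MvPolynomial (Fin ℓ) K :=
  A.exists_isDefiningPolynomial.choose

/-- The module `D^(m)(A) = {θ ∈ D^(m)(S) | θ(QS) ⊆ QS}` of `m`-th order `A`-differential
operators. -/
def diffOps {K : Type*} [Field K] {ℓ : ℕ} (A : CentralArrangement K (Fin ℓ → K)) (m : ℕ) :
    Submodule (MvPolynomial (Fin ℓ) K) (Module.End K (MvPolynomial (Fin ℓ) K)) :=
  diffOpsPreserving m (Ideal.span {A.definingPolynomial})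

/-- `A` is `m`-free if `D^(m)(A)` is a free `S`-module. -/
def IsMFree {K : Type*} [Field K] {ℓ : ℕ} (A : CentralArrangement K (Fin ℓ → K)) (m : ℕ) : Prop :=
  Module.Free (MvPolynomial (Fin ℓ) K) (A.diffOps m)

/-- `H₁ ↦ H₁ ⊕ V₂` and `H₂ ↦ V₁ ⊕ H₂`: the hyperplanes of the product arrangement in `V₁ ⊕ V₂`. -/
def prod {K V₁ V₂ : Type*} [Field K] [AddCommGroup V₁] [Module K V₁] [AddCommGroup V₂]
    [Module K V₂] (A₁ : CentralArrangement K V₁) (A₂ : CentralArrangement K V₂) :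
    CentralArrangement K (V₁ × V₂) where
  hyperplanes := (fun H => H.prod ⊤) '' A₁.hyperplanes ∪ (fun H => Submodule.prod ⊤ H) '' A₂.hyperplanes
  finite := (A₁.finite.image _).union (A₂.finite.image _)
  isHyperplane := by
    rintro _ (⟨H, hH, rfl⟩ | ⟨H, hH, rfl⟩)
    · obtain ⟨α, h0, rfl⟩ := A₁.isHyperplane H hH
      refine ⟨α ∘ₗ LinearMap.fst K V₁ V₂, fun h => h0 ?_, ?_⟩
      · ext v
        simpa using LinearMap.congr_fun h (v, 0)
      · ext v
        simp
    · obtain ⟨α, h0, rfl⟩ := A₂.isHyperplane H hH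
      refine ⟨α ∘ₗ LinearMap.snd K V₁ V₂, fun h => h0 ?_, ?_⟩
      · ext v
        simpa using LinearMap.congr_fun h (0, v)
      · ext v
        simp

/-- `A` is reducible if some linear change of coordinates `e` carries it to a product of
arrangements in two spaces of positive dimension. -/
def IsReducible {K : Type*} [Field K] {ℓ : ℕ} (A : CentralArrangement K (Fin ℓ → K)) : Prop :=
  ∃ (ℓ₁ ℓ₂ : ℕ) (A₁ : CentralArrangement K (Fin ℓ₁ → K)) (A₂ : CentralArrangement K (Fin ℓ₂ → K))
    (e : (Fin ℓ → K) ≃ₗ[K] (Fin ℓ₁ → K) × (Fin ℓ₂ → K)), 0 < ℓ₁ ∧ 0 < ℓ₂ ∧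
      (fun H => H.map e.toLinearMap) '' A.hyperplanes = (A₁.prod A₂).hyperplanes

/-- `A` is irreducible if it is not reducible. -/
def IsIrreducible {K : Type*} [Field K] {ℓ : ℕ} (A : CentralArrangement K (Fin ℓ → K)) : Prop :=
  ¬ A.IsReducible

end CentralArrangement

end

/-! ### Linear forms as primes; independence of the defining polynomial -/

section LinearForms

variable {K : Type*} [Field K] {ℓ : ℕ}

/-! Write `Q = q r` with `q = xyz(x+y+z)` free of `w` and `r = w(x+y+z+w)`, and let `m = k + 1`. The
operators `r yz (∂_y - ∂_z) ∂_w^k` and its two cyclic shifts in `x, y, z` preserve `QS`, and they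
satisfy a linear relation with coefficients `x, y, z`. A free module is flat, so this relation would
be trivial: the operators would be combinations `∑ a_ij η_j` of elements of the module, with `∑ x_i
a_ij = 0`. Hence every `a_0j` vanishes at `P = (0,0,0,1)`.

Taking the commutator with `w` exactly `k` times turns each `η_j` into a derivation preserving `QS`.
It multiplies `y` and `x+y+z` by polynomials `b_j, d_j` that agree at `P`
(`exists_logarithmic_coeffs`). Comparing the values of the first operator on `y` and `x+y+z` gives
`k! r z = ∑ a_0j (b_j - d_j)`. The right side vanishes to order two at `P`, while the left side has
`z`-derivative `k!` there, which is nonzero in characteristic zero (`not_free_diffOpsPreserving`).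

Irreducibility: in a product every form vanishes on one of the two summands. The coordinate forms
then put each basis vector in a summand, and `x+y+z+w` forces all of them into the same one. -/

theorem eval_linearFormPoly (α : Module.Dual K (Fin ℓ → K)) (v : Fin ℓ → K) :
    eval v (linearFormPoly α) = α v := by
  have : v = ∑ i, v i • (Pi.single i 1 : Fin ℓ → K) := by
    ext j
    simp [Finset.sum_apply, Pi.single_apply]
  conv_rhs => rw [this]
  simp [linearFormPoly, mul_comm]

theorem linearFormPoly_smul (c : K) (α : Module.Dual K (Fin ℓ → K)) :
    linearFormPoly (c • α) = C c * linearFormPoly α := by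
  simp [linearFormPoly, Finset.mul_sum, mul_assoc]

theorem coeff_linearFormPoly (α : Module.Dual K (Fin ℓ → K)) (i : Fin ℓ) :
    coeff (Finsupp.single i 1) (linearFormPoly α) = α (Pi.single i 1) := by
  simp [linearFormPoly, coeff_sum, coeff_C_mul, coeff_X, Finsupp.single_left_inj]

theorem exists_apply_single_ne_zero {α : Module.Dual K (Fin ℓ → K)} (h : α ≠ 0) :
    ∃ i, α (Pi.single i 1) ≠ 0 := by
  by_contra! h0
  exact h (LinearMap.pi_ext' fun i => LinearMap.ext_ring (by simpa using h0 i))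

theorem prime_linearFormPoly {α : Module.Dual K (Fin ℓ → K)} (h : α ≠ 0) :
    Prime (linearFormPoly α) := by
  obtain ⟨i, hi⟩ := exists_apply_single_ne_zero h
  have hcoeff := coeff_linearFormPoly α i
  refine (irreducible_of_totalDegree_eq_one (le_antisymm ?_ ?_) fun x hx => ?_).prime
  · refine totalDegree_finsetSum_le fun j _ => ?_
    refine (totalDegree_mul _ _).trans ?_
    simp
  · have := le_totalDegree (p := linearFormPoly α) (s := Finsupp.single i 1)
      (by rw [mem_support_iff, hcoeff]; exact hi)
    simpa using this
  · rw [isUnit_iff_ne_zero]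
    rintro rfl
    have := hx (Finsupp.single i 1)
    rw [hcoeff, zero_dvd_iff] at this
    exact hi this

theorem exists_smul_eq_of_ker_le {α β : Module.Dual K (Fin ℓ → K)} (hβ : β ≠ 0)
    (h : LinearMap.ker α ≤ LinearMap.ker β) :
    ∃ c : K, c ≠ 0 ∧ β = c • α := by
  have : β ∈ Submodule.span K (Set.range fun _ : Unit => α) :=
    mem_span_of_iInf_ker_le_ker (by simpa using h)
  rw [Set.range_const, Submodule.mem_span_singleton] at this
  obtain ⟨c, rfl⟩ := this
  exact ⟨c, fun hc => hβ (by simp [hc]), rfl⟩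

theorem ker_eq_of_linearFormPoly_dvd {α β : Module.Dual K (Fin ℓ → K)} (hβ : β ≠ 0)
    (h : linearFormPoly α ∣ linearFormPoly β) : LinearMap.ker α = LinearMap.ker β := by
  obtain ⟨q, hq⟩ := h
  obtain ⟨c, hc, rfl⟩ := exists_smul_eq_of_ker_le hβ fun v (hv : α v = 0) => by
    rw [LinearMap.mem_ker, ← eval_linearFormPoly, hq, map_mul, eval_linearFormPoly, hv, zero_mul]
  exact (LinearMap.ker_smul α c hc).symm

namespace CentralArrangement

theorem form_ne_zero (A : CentralArrangement K (Fin ℓ → K))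
    {α : Submodule K (Fin ℓ → K) → Module.Dual K (Fin ℓ → K)}
    (hα : ∀ H ∈ A.hyperplanes, LinearMap.ker (α H) = H) {H : Submodule K (Fin ℓ → K)}
    (hH : H ∈ A.hyperplanes) : α H ≠ 0 := by
  intro h0
  obtain ⟨β, hβ, rfl⟩ := A.isHyperplane H hH
  have := hα _ hH
  rw [h0, LinearMap.ker_zero] at this
  exact hβ (LinearMap.ker_eq_top.1 this.symm)

theorem IsDefiningPolynomial.associated {A : CentralArrangement K (Fin ℓ → K)}
    {P Q : MvPolynomial (Fin ℓ) K} (hP : A.IsDefiningPolynomial P)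
    (hQ : A.IsDefiningPolynomial Q) : Associated P Q := by
  obtain ⟨α, hα, rfl⟩ := hP
  obtain ⟨β, hβ, rfl⟩ := hQ
  refine Associated.prod _ _ _ fun H hH => ?_
  rw [Set.Finite.mem_toFinset] at hH
  obtain ⟨c, hc, h⟩ := exists_smul_eq_of_ker_le (A.form_ne_zero hβ hH)
    ((hα H hH).trans (hβ H hH).symm).le
  rw [h, linearFormPoly_smul, mul_comm]
  exact associated_mul_unit_right _ _ ((isUnit_iff_ne_zero.2 hc).map C)

theorem diffOps_eq {A : CentralArrangement K (Fin ℓ → K)}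
    {Q : MvPolynomial (Fin ℓ) K} (hQ : A.IsDefiningPolynomial Q) (m : ℕ) :
    A.diffOps m = diffOpsPreserving m (Ideal.span {Q}) := by
  rw [diffOps, Ideal.span_singleton_eq_span_singleton.2
    (IsDefiningPolynomial.associated
      (show A.IsDefiningPolynomial A.definingPolynomial from
        A.exists_isDefiningPolynomial.choose_spec) hQ)]

theorem IsDefiningPolynomial.ker_mem {A : CentralArrangement K (Fin ℓ → K)}
    {Q : MvPolynomial (Fin ℓ) K} (hQ : A.IsDefiningPolynomial Q)
    {φ : Module.Dual K (Fin ℓ → K)} (hφ : φ ≠ 0) (h : linearFormPoly φ ∣ Q) :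
    LinearMap.ker φ ∈ A.hyperplanes := by
  obtain ⟨α, hα, rfl⟩ := hQ
  obtain ⟨H, hH, hd⟩ := (prime_linearFormPoly hφ).exists_mem_finset_dvd h
  rw [Set.Finite.mem_toFinset] at hH
  rw [ker_eq_of_linearFormPoly_dvd (A.form_ne_zero hα hH) hd, hα H hH]
  exact hH

theorem exists_of_injective_ker {ι : Type*} [Fintype ι] (φ : ι → Module.Dual K (Fin ℓ → K))
    (h0 : ∀ i, φ i ≠ 0) (hinj : Function.Injective fun i => LinearMap.ker (φ i)) :
    ∃ A : CentralArrangement K (Fin ℓ → K),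
      A.IsDefiningPolynomial (∏ i, linearFormPoly (φ i)) := by
  classical
  refine ⟨⟨Set.range fun i => LinearMap.ker (φ i), Set.finite_range _, ?_⟩, ?_⟩
  · rintro _ ⟨i, rfl⟩
    exact ⟨φ i, h0 i, rfl⟩
  · rcases isEmpty_or_nonempty ι with _ | _
    · exact ⟨0, by simp, by simp⟩
    choose! g hg using fun (H : Submodule K (Fin ℓ → K))
      (hH : H ∈ Set.range fun i => LinearMap.ker (φ i)) => hH
    refine ⟨fun H => φ (g H), hg, ?_⟩
    have : (Set.finite_range fun i => LinearMap.ker (φ i)).toFinset =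
        Finset.univ.image fun i => LinearMap.ker (φ i) := by
      ext; simp
    simp only [this]
    rw [Finset.prod_image fun i _ j _ h => hinj h]
    refine Finset.prod_congr rfl fun i _ => ?_
    rw [hinj (hg _ ⟨i, rfl⟩)]

end CentralArrangement

end LinearForms

/-! ### Commutators with multiplication operators -/

/-- The commutator `θ ↦ θ ∘ f - f • θ` with multiplication by `f`. -/
noncomputable def mulCommutator {K : Type*} [Field K] {ℓ : ℕ} (f : MvPolynomial (Fin ℓ) K) :
    Module.End (MvPolynomial (Fin ℓ) K) (Module.End K (MvPolynomial (Fin ℓ) K)) where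
  toFun θ := θ * LinearMap.mulLeft K f - f • θ
  map_add' θ η := by rw [add_mul, smul_add]; abel
  map_smul' g θ := by
    refine LinearMap.ext fun p => ?_
    simp [mul_sub, mul_left_comm]

section Commutator

variable {K : Type*} [Field K] {ℓ : ℕ}

theorem mulCommutator_apply (f : MvPolynomial (Fin ℓ) K)
    (θ : Module.End K (MvPolynomial (Fin ℓ) K)) (p : MvPolynomial (Fin ℓ) K) :
    mulCommutator f θ p = θ (f * p) - f * θ p := rfl

theorem mulCommutator_preserves {f : MvPolynomial (Fin ℓ) K} {I : Ideal (MvPolynomial (Fin ℓ) K)}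
    {θ : Module.End K (MvPolynomial (Fin ℓ) K)} (h : ∀ g ∈ I, θ g ∈ I) :
    ∀ g ∈ I, mulCommutator f θ g ∈ I := fun g hg =>
  sub_mem (h _ (I.mul_mem_left f hg)) (I.mul_mem_left f (h g hg))

theorem mulCommutator_pow_preserves {f : MvPolynomial (Fin ℓ) K}
    {I : Ideal (MvPolynomial (Fin ℓ) K)} (k : ℕ) {θ : Module.End K (MvPolynomial (Fin ℓ) K)}
    (h : ∀ g ∈ I, θ g ∈ I) : ∀ g ∈ I, (mulCommutator f ^ k) θ g ∈ I := by
  induction k with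
  | zero => simpa using h
  | succ k ih =>
    rw [pow_succ', Module.End.mul_apply]
    exact mulCommutator_preserves ih

theorem mulCommutator_mul_of_commute {f : MvPolynomial (Fin ℓ) K}
    {A : Module.End K (MvPolynomial (Fin ℓ) K)} (hA : ∀ p, A (f * p) = f * A p)
    (B : Module.End K (MvPolynomial (Fin ℓ) K)) :
    mulCommutator f (A * B) = A * mulCommutator f B := by
  refine LinearMap.ext fun p => ?_
  simp only [mulCommutator_apply, Module.End.mul_apply, map_sub, hA]

theorem pderiv_pow_X_mul (i : Fin ℓ) (k : ℕ) (p : MvPolynomial (Fin ℓ) K) :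
    ((pderiv i).toLinearMap ^ (k + 1) : Module.End K (MvPolynomial (Fin ℓ) K)) (X i * p) =
      X i * ((pderiv i).toLinearMap ^ (k + 1) : Module.End K (MvPolynomial (Fin ℓ) K)) p +
        ((k + 1 : ℕ) : MvPolynomial (Fin ℓ) K) *
          ((pderiv i).toLinearMap ^ k : Module.End K (MvPolynomial (Fin ℓ) K)) p := by
  induction k with
  | zero => simp
  | succ k ih =>
    rw [pow_succ', Module.End.mul_apply, ih, map_add]
    simp only [Derivation.coeFn_coe, pow_succ' _ k, Module.End.mul_apply,
      Derivation.leibniz, pderiv_X_self, smul_eq_mul, Derivation.map_natCast]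
    push_cast
    ring

theorem mulCommutator_X_pderiv_pow (i : Fin ℓ) (k : ℕ) :
    mulCommutator (X i) ((pderiv i).toLinearMap ^ (k + 1) : Module.End K (MvPolynomial (Fin ℓ) K)) =
      ((k + 1 : ℕ) : MvPolynomial (Fin ℓ) K) • (pderiv i).toLinearMap ^ k := by
  refine LinearMap.ext fun p => ?_
  rw [mulCommutator_apply, pderiv_pow_X_mul]
  simp

theorem pderiv_pow_X_mul_of_ne {i j : Fin ℓ} (h : j ≠ i) (k : ℕ) (p : MvPolynomial (Fin ℓ) K) :
    ((pderiv i).toLinearMap ^ k : Module.End K (MvPolynomial (Fin ℓ) K)) (X j * p) =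
      X j * ((pderiv i).toLinearMap ^ k : Module.End K (MvPolynomial (Fin ℓ) K)) p := by
  induction k with
  | zero => simp
  | succ k ih =>
    rw [pow_succ', Module.End.mul_apply, ih]
    simp [pderiv_X_of_ne h]

/-- By Leibniz, `D (p * q)` is `q * D p` modulo `p`, and the prime `p` does not divide `q`. -/
theorem derivation_dvd_of_preserves {D : Module.End K (MvPolynomial (Fin ℓ) K)}
    (hD : ∀ f g, D (f * g) = f * D g + g * D f) {p q : MvPolynomial (Fin ℓ) K} (hp : Prime p)
    (hpq : ¬ p ∣ q) (h : ∀ f ∈ Ideal.span {p * q}, D f ∈ Ideal.span {p * q}) : p ∣ D p := by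
  have h1 := Ideal.mem_span_singleton.1 (h _ (Ideal.mem_span_singleton_self _))
  rw [hD] at h1
  have h2 : p ∣ q * D p :=
    (dvd_add_right (dvd_mul_right p _)).1 ((dvd_mul_right p q).trans h1)
  exact (hp.dvd_or_dvd h2).resolve_left hpq

end Commutator

/-! ### Lowering the order by commutators with `w` -/

section FourVariables

variable {K : Type*} [Field K]

theorem partialOp_four (a : Fin 4 → ℕ) :
    partialOp K a = (pderiv 0).toLinearMap ^ a 0 * (pderiv 1).toLinearMap ^ a 1 *
      (pderiv 2).toLinearMap ^ a 2 * (pderiv 3).toLinearMap ^ a 3 := by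
  simp [partialOp, List.ofFn_succ, mul_assoc]

/-- Operators homogeneous of order one have no multiplication term, so they are combinations of the
`∂_i`. -/
theorem leibniz_of_mem_diffOpsOfOrder_one {θ : Module.End K (MvPolynomial (Fin 4) K)}
    (h : θ ∈ diffOpsOfOrder K 4 1) (f g : MvPolynomial (Fin 4) K) :
    θ (f * g) = f * θ g + g * θ f := by
  induction h using Submodule.span_induction with
  | mem θ h =>
    obtain ⟨a, ha, rfl⟩ := h
    obtain ⟨i, rfl⟩ : ∃ i, a = Pi.single i 1 := by
      obtain ⟨i, -, hi⟩ : ∃ i ∈ Finset.univ, a i ≠ 0 := by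
        by_contra! h0
        simp [Finset.sum_eq_zero h0] at ha
      have hs := Finset.add_sum_erase Finset.univ a (Finset.mem_univ i)
      refine ⟨i, funext fun j => ?_⟩
      rcases eq_or_ne j i with rfl | hj
      · simp; omega
      · have := Finset.single_le_sum (f := a) (fun _ _ => Nat.zero_le _)
          (Finset.mem_erase.2 ⟨hj, Finset.mem_univ j⟩)
        simp [hj]; omega
    have : partialOp K (Pi.single i 1) = (pderiv i).toLinearMap := by
      rw [partialOp_four]
      fin_cases i <;> simp
    rw [this]
    simp
  | zero => simp
  | add θ η _ _ hθ hη => simp only [LinearMap.add_apply, hθ, hη]; ring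
  | smul c θ _ hθ => simp only [LinearMap.smul_apply, hθ, smul_eq_mul]; ring

/-- `X 3` commutes with `∂_0, ∂_1, ∂_2`, so the commutator only sees the power of `∂_3`: it lowers a
positive exponent by one and kills exponent zero. -/
theorem mulCommutator_mem_diffOpsOfOrder {n : ℕ} {θ : Module.End K (MvPolynomial (Fin 4) K)}
    (h : θ ∈ diffOpsOfOrder K 4 (n + 1)) : mulCommutator (X 3) θ ∈ diffOpsOfOrder K 4 n := by
  induction h using Submodule.span_induction with
  | mem θ h =>
    obtain ⟨a, ha, rfl⟩ := h
    rw [partialOp_four, mulCommutator_mul_of_commute]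
    · rcases hk : a 3 with _ | k
      · have : mulCommutator (X 3) (1 : Module.End K (MvPolynomial (Fin 4) K)) = 0 := by
          refine LinearMap.ext fun p => ?_
          simp [mulCommutator_apply]
        simp [this]
      · rw [mulCommutator_X_pderiv_pow]
        have : ∀ (A B : Module.End K (MvPolynomial (Fin 4) K)) (n : ℕ),
            A * ((n : MvPolynomial (Fin 4) K) • B) = (n : MvPolynomial (Fin 4) K) • (A * B) := by
          intro A B n
          simp only [Nat.cast_smul_eq_nsmul, mul_smul_comm]
        rw [this]
        refine Submodule.smul_mem _ _ (Submodule.subset_span ⟨Function.update a 3 k, ?_, ?_⟩)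
        · simp [Fin.sum_univ_four] at ha ⊢
          omega
        · rw [partialOp_four]
          simp
    · intro p
      simp only [Module.End.mul_apply]
      rw [pderiv_pow_X_mul_of_ne (by decide), pderiv_pow_X_mul_of_ne (by decide),
        pderiv_pow_X_mul_of_ne (by decide)]
  | zero => simp
  | add θ η _ _ hθ hη => rw [map_add]; exact add_mem hθ hη
  | smul c θ _ hθ => rw [map_smul]; exact Submodule.smul_mem _ c hθ

theorem mulCommutator_pow_mem_diffOpsOfOrder {n k : ℕ}
    {θ : Module.End K (MvPolynomial (Fin 4) K)} (h : θ ∈ diffOpsOfOrder K 4 (n + k)) :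
    (mulCommutator (X 3) ^ k) θ ∈ diffOpsOfOrder K 4 n := by
  induction k generalizing θ with
  | zero => simpa using h
  | succ k ih =>
    rw [pow_succ, Module.End.mul_apply]
    exact ih (mulCommutator_mem_diffOpsOfOrder h)

/-- The operator `∂_i ∂_3 ^ k`. -/
noncomputable def pderivMulPow (K : Type*) [Field K] (i : Fin 4) (k : ℕ) :
    Module.End K (MvPolynomial (Fin 4) K) :=
  (pderiv i).toLinearMap * (pderiv 3).toLinearMap ^ k

theorem pderivMulPow_mem (i : Fin 3) (k : ℕ) :
    pderivMulPow K i.castSucc k ∈ diffOpsOfOrder K 4 (k + 1) := by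
  refine Submodule.subset_span ⟨fun j => if j = 3 then k else if j = i.castSucc then 1 else 0, ?_, ?_⟩
  · fin_cases i <;> simp [Fin.sum_univ_four] <;> omega
  · rw [partialOp_four]
    fin_cases i <;> simp [pderivMulPow]

theorem mulCommutator_pow_pderivMulPow (i : Fin 3) (k : ℕ) :
    (mulCommutator (X 3) ^ k) (pderivMulPow K i.castSucc k) =
      (k.factorial : MvPolynomial (Fin 4) K) • (pderiv i.castSucc).toLinearMap := by
  have hne : (3 : Fin 4) ≠ i.castSucc := by fin_cases i <;> decide
  induction k with
  | zero => simp [pderivMulPow]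
  | succ k ih =>
    have : mulCommutator (X 3) (pderivMulPow K i.castSucc (k + 1)) =
        ((k + 1 : ℕ) : MvPolynomial (Fin 4) K) • pderivMulPow K i.castSucc k := by
      rw [pderivMulPow, mulCommutator_mul_of_commute, mulCommutator_X_pderiv_pow]
      · simp only [Nat.cast_smul_eq_nsmul, mul_smul_comm, pderivMulPow]
      · intro p
        simpa using pderiv_pow_X_mul_of_ne hne 1 p
    rw [pow_succ, Module.End.mul_apply, this, map_smul, ih, smul_smul, ← Nat.cast_mul,
      Nat.factorial_succ]

end FourVariables

/-! ### The six forms of the example -/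

/-- The coefficient vectors of `x, y, z, w, x + y + z, x + y + z + w`. -/
def formCoeff : Fin 6 → Fin 4 → ℕ :=
  ![![1, 0, 0, 0], ![0, 1, 0, 0], ![0, 0, 1, 0], ![0, 0, 0, 1], ![1, 1, 1, 0], ![1, 1, 1, 1]]

/-- The linear forms `x, y, z, w, x + y + z, x + y + z + w`. -/
noncomputable def form (K : Type*) [Field K] (i : Fin 6) : Module.Dual K (Fin 4 → K) :=
  ∑ k, (formCoeff i k : K) • LinearMap.proj k

section Example

variable {K : Type*} [Field K]

theorem form_apply (i : Fin 6) (v : Fin 4 → K) : form K i v = ∑ k, (formCoeff i k : K) * v k := by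
  simp [form]

theorem form_single (i : Fin 6) (k : Fin 4) : form K i (Pi.single k 1) = formCoeff i k := by
  simp [form_apply, Pi.single_apply]

theorem linearFormPoly_form (i : Fin 6) :
    linearFormPoly (form K i) = ∑ k, (formCoeff i k : MvPolynomial (Fin 4) K) * X k := by
  simp [linearFormPoly, form_single]

theorem form_ker_injective [CharZero K] :
    Function.Injective fun i => LinearMap.ker (form K i) := by
  intro i j h
  -- A kernel determines which basis vectors it contains, hence the support of the form; the six
  -- supports are distinct.
  have h1 : ∀ k, formCoeff i k = 0 ↔ formCoeff j k = 0 := fun k => by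
    have := SetLike.ext_iff.1 h (Pi.single k 1)
    simpa [form_single] using this
  revert h1
  clear h
  revert i j
  decide

theorem form_ne_zero [CharZero K] (i : Fin 6) : form K i ≠ 0 := by
  intro h
  have h1 : ∀ k, formCoeff i k = 0 := fun k => by
    have := form_single (K := K) i k
    rw [h] at this
    simpa using this.symm
  revert h1
  clear h
  revert i
  decide

theorem prod_linearFormPoly_form :
    ∏ i, linearFormPoly (form K i) =
      X 0 * X 1 * X 2 * X 3 * (X 0 + X 1 + X 2) * (X 0 + X 1 + X 2 + X 3) := by
  simp [Fin.prod_univ_six, linearFormPoly_form, Fin.sum_univ_four, formCoeff]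

/-! ### Irreducibility -/

theorem isIrreducible_of_ker_form_mem (A : CentralArrangement K (Fin 4 → K))
    (hA : ∀ i, LinearMap.ker (form K i) ∈ A.hyperplanes) : A.IsIrreducible := by
  rintro ⟨ℓ₁, ℓ₂, A₁, A₂, e, h₁, h₂, he⟩
  have key : ∀ i, (∀ v, form K i (e.symm (0, v)) = 0) ∨ (∀ u, form K i (e.symm (u, 0)) = 0) := by
    intro i
    have hm : (LinearMap.ker (form K i)).map e.toLinearMap ∈ (A₁.prod A₂).hyperplanes :=
      he ▸ ⟨_, hA i, rfl⟩
    have hmem : ∀ p, p ∈ (LinearMap.ker (form K i)).map e.toLinearMap →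
        form K i (e.symm p) = 0 := by
      rintro _ ⟨v, hv, rfl⟩
      simpa using hv
    rcases hm with ⟨H, -, hH⟩ | ⟨H, -, hH⟩
    · refine Or.inl fun v => hmem _ ?_
      rw [← hH]
      exact ⟨H.zero_mem, trivial⟩
    · refine Or.inr fun u => hmem _ ?_
      rw [← hH]
      exact ⟨trivial, H.zero_mem⟩
  have hcoord : ∀ (k : Fin 4), (∀ v, e.symm (0, v) k = 0) ∨ (∀ u, e.symm (u, 0) k = 0) := by
    intro k
    have := key (Fin.castLE (by decide) k)
    have hf : ∀ v : Fin 4 → K, form K (Fin.castLE (by decide) k) v = v k := fun v => by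
      rw [form_apply]
      fin_cases k <;> simp [Fin.sum_univ_four, formCoeff]
    simpa only [hf] using this
  have hsum : ∀ v : Fin 4 → K, form K 5 v = ∑ k, v k := fun v => by
    simp [form_apply, Fin.sum_univ_four, formCoeff]
  have hsplit : ∀ (p : (Fin ℓ₁ → K) × (Fin ℓ₂ → K)),
      e.symm p = e.symm (p.1, 0) + e.symm (0, p.2) := fun p => by
    rw [← map_add]; simp
  -- Split a basis vector along the summands. The component in the summand killed by coordinate `k`
  -- has `k`-th entry zero; at any other `j` the entries sum to zero and one of them vanishes, so
  -- both do.
  have hbasis : ∀ k : Fin 4, (∃ u, e.symm (u, 0) = Pi.single k 1) ∨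
      (∃ v, e.symm (0, v) = Pi.single k 1) := by
    intro k
    obtain ⟨p, hp⟩ := e.symm.surjective (Pi.single k 1)
    have hj := fun j => congrFun (hp.symm.trans (hsplit p)) j
    simp only [Pi.add_apply] at hj
    rcases hcoord k with hk | hk
    · refine Or.inl ⟨p.1, funext fun j => ?_⟩
      rcases eq_or_ne j k with rfl | hjk
      · rw [hj, hk, add_zero]
      · rw [Pi.single_eq_of_ne hjk]
        rcases hcoord j with h | h
        · have := hj j
          rw [Pi.single_eq_of_ne hjk, h, add_zero] at this
          exact this.symm
        · exact h _
    · refine Or.inr ⟨p.2, funext fun j => ?_⟩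
      rcases eq_or_ne j k with rfl | hjk
      · rw [hj, hk, zero_add]
      · rw [Pi.single_eq_of_ne hjk]
        rcases hcoord j with h | h
        · exact h _
        · have := hj j
          rw [Pi.single_eq_of_ne hjk, h, zero_add] at this
          exact this.symm
  rcases key 5 with h | h
  · have hzero : ∀ v, e.symm (0, v) = 0 := by
      intro v
      ext k
      rcases hbasis k with ⟨u, hu⟩ | ⟨v', hv'⟩
      · rcases hcoord k with h' | h'
        · exact h' v
        · simpa [hu] using h' u
      · have := h v'
        simp [hsum, hv'] at this
    have := hzero (Pi.single ⟨0, h₂⟩ 1)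
    rw [LinearEquiv.map_eq_zero_iff, Prod.mk_eq_zero] at this
    simp at this
  · have hzero : ∀ u, e.symm (u, 0) = 0 := by
      intro u
      ext k
      rcases hbasis k with ⟨u', hu'⟩ | ⟨v, hv⟩
      · have := h u'
        simp [hsum, hu'] at this
      · rcases hcoord k with h' | h'
        · simpa [hv] using h' v
        · exact h' u
    have := hzero (Pi.single ⟨0, h₁⟩ 1)
    rw [LinearEquiv.map_eq_zero_iff, Prod.mk_eq_zero] at this
    simp at this

/-! ### Logarithmic derivations and failure of freeness -/

theorem linearFormPoly_form_dvd_derivation [CharZero K]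
    {D : Module.End K (MvPolynomial (Fin 4) K)}
    (hD : ∀ f g, D (f * g) = f * D g + g * D f)
    (h : ∀ f ∈ Ideal.span {∏ i, linearFormPoly (form K i)},
      D f ∈ Ideal.span {∏ i, linearFormPoly (form K i)}) (i : Fin 6) :
    linearFormPoly (form K i) ∣ D (linearFormPoly (form K i)) := by
  classical
  rw [← Finset.mul_prod_erase _ _ (Finset.mem_univ i)] at h
  have hp := prime_linearFormPoly (form_ne_zero (K := K) i)
  refine derivation_dvd_of_preserves hD hp (fun hd => ?_) h
  obtain ⟨j, hj, hij⟩ := hp.exists_mem_finset_dvd hd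
  exact (Finset.mem_erase.1 hj).1
    (form_ker_injective (ker_eq_of_linearFormPoly_dvd (form_ne_zero j) hij)).symm

/-- A relation `x f + y g + z h = 0` forces `f`, `g`, `h` to vanish on `x = y = z = 0`. -/
theorem eval_eq_zero_of_syzygy {f : Fin 3 → MvPolynomial (Fin 4) K}
    (h : ∑ i, X i.castSucc * f i = 0) (i : Fin 3) : eval ![0, 0, 0, 1] (f i) = 0 := by
  -- At this point `x = y = z = 0`, so only the term that differentiates the factor `X i.castSucc`
  -- survives.
  have h1 := congrArg (fun p => eval ![0, 0, 0, 1] (pderiv i.castSucc p)) h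
  fin_cases i <;> simpa [Fin.sum_univ_three, pderiv_X, Pi.single_apply] using h1

/-- A derivation preserving the arrangement acts on `x, y, z, x + y + z` by multiplication by
polynomials which agree on `x = y = z = 0`. -/
theorem exists_logarithmic_coeffs [CharZero K] {D : Module.End K (MvPolynomial (Fin 4) K)}
    (hD : ∀ f g, D (f * g) = f * D g + g * D f)
    (h : ∀ f ∈ Ideal.span {∏ i, linearFormPoly (form K i)},
      D f ∈ Ideal.span {∏ i, linearFormPoly (form K i)}) :
    ∃ b d : MvPolynomial (Fin 4) K, D (X 1) = X 1 * b ∧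
      D (X 0 + X 1 + X 2) = (X 0 + X 1 + X 2) * d ∧ eval ![0, 0, 0, 1] (b - d) = 0 := by
  have hdvd := linearFormPoly_form_dvd_derivation hD h
  obtain ⟨a, ha⟩ := hdvd 0
  obtain ⟨b, hb⟩ := hdvd 1
  obtain ⟨c, hc⟩ := hdvd 2
  obtain ⟨d, hd⟩ := hdvd 4
  simp [linearFormPoly_form, Fin.sum_univ_four, formCoeff] at ha hb hc
  simp only [linearFormPoly_form, Fin.sum_univ_four, formCoeff, Matrix.cons_val, Nat.cast_one,
    Nat.cast_zero, one_mul, zero_mul, add_zero] at hd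
  refine ⟨b, d, hb, hd, ?_⟩
  -- Additivity of `D` on `x + y + z` gives `x a + y b + z c = (x + y + z) d`.
  have := eval_eq_zero_of_syzygy (K := K) (f := ![a - d, b - d, c - d]) (by
    rw [map_add, map_add, ha, hb, hc] at hd
    simp only [Fin.sum_univ_three, Matrix.cons_val, Fin.castSucc_zero, Fin.castSucc_one,
      Fin.reduceCastSucc]
    linear_combination hd) 1
  simpa using this

/-- `∂_3^k` commutes with `q`, and `s (∂_i - ∂_j)` preserves `qS`. The factor `r` need not survive
differentiation, because the coefficient `g` restores it. -/
theorem smul_pderivMulPow_sub_mem (i j : Fin 3) (k : ℕ) {Q q r s g : MvPolynomial (Fin 4) K}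
    (hQ : Q = q * r)
    (hq : ∀ p, pderiv 3 (q * p) = q * pderiv 3 p)
    (hs : ∀ p, q ∣ s * pderiv i.castSucc (q * p) - s * pderiv j.castSucc (q * p))
    (hg : g = r * s) :
    g • (pderivMulPow K i.castSucc k - pderivMulPow K j.castSucc k) ∈
      diffOpsPreserving (k + 1) (Ideal.span {Q}) := by
  refine ⟨Submodule.smul_mem _ _ (sub_mem (pderivMulPow_mem i k) (pderivMulPow_mem j k)), ?_⟩
  intro f hf
  obtain ⟨p, rfl⟩ := Ideal.mem_span_singleton.1 hf
  rw [Ideal.mem_span_singleton]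
  have hpow : ∀ p, ((pderiv 3).toLinearMap ^ k : Module.End K (MvPolynomial (Fin 4) K)) (q * p) =
      q * ((pderiv 3).toLinearMap ^ k : Module.End K (MvPolynomial (Fin 4) K)) p := by
    clear hf
    induction k with
    | zero => simp
    | succ k ih =>
      intro p
      rw [pow_succ', Module.End.mul_apply, ih]
      exact hq _
  simp only [LinearMap.smul_apply, LinearMap.sub_apply, pderivMulPow, Module.End.mul_apply,
    smul_eq_mul, hQ, mul_assoc, hpow, Derivation.coeFn_coe, hg]
  rw [mul_comm q r, mul_sub]
  exact mul_dvd_mul_left _ (hs _)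

theorem not_free_diffOpsPreserving [CharZero K] (k : ℕ) :
    ¬ Module.Free (MvPolynomial (Fin 4) K)
      (diffOpsPreserving (k + 1) (Ideal.span {∏ i, linearFormPoly (form K i)})) := by
  intro hfree
  set Q := ∏ i, linearFormPoly (form K i) with hQdef
  set q : MvPolynomial (Fin 4) K := X 0 * X 1 * X 2 * (X 0 + X 1 + X 2) with hqdef
  set r : MvPolynomial (Fin 4) K := X 3 * (X 0 + X 1 + X 2 + X 3) with hrdef
  have hQ : Q = q * r := by rw [hQdef, prod_linearFormPoly_form, hqdef, hrdef]; ring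
  have hq : ∀ p, pderiv 3 (q * p) = q * pderiv 3 p := by
    intro p
    simp [hqdef, pderiv_X]
  have hmem : ∀ i : Fin 3, (r * (X (i + 1).castSucc * X (i + 2).castSucc)) •
      (pderivMulPow K (i + 1).castSucc k - pderivMulPow K (i + 2).castSucc k) ∈
      diffOpsPreserving (k + 1) (Ideal.span {Q}) := by
    intro i
    refine smul_pderivMulPow_sub_mem _ _ k hQ hq (fun p => ?_) rfl
    -- Quotient by `q`: `∂_{i+1} - ∂_{i+2}` kills `x+y+z` and the remaining variable, so the extra
    -- term comes from the two named variables alone.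
    refine ⟨X (i + 1).castSucc * X (i + 2).castSucc *
      (pderiv (i + 1).castSucc p - pderiv (i + 2).castSucc p) +
      (X (i + 2).castSucc - X (i + 1).castSucc) * p, ?_⟩
    fin_cases i <;> simp [hqdef, pderiv_X] <;> ring
  -- Each operator times its missing variable has coefficient `r xyz`, and the cyclic differences of
  -- `∂_x, ∂_y, ∂_z` sum to zero.
  obtain ⟨n, a, η, hη, hsyz⟩ := Module.Flat.isTrivialRelation_of_sum_smul_eq_zero
    (f := fun i : Fin 3 => (X i.castSucc : MvPolynomial (Fin 4) K))
    (x := fun i => (⟨_, hmem i⟩ : diffOpsPreserving (k + 1) (Ideal.span {Q}))) (by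
      apply Subtype.ext
      refine LinearMap.ext fun p => ?_
      simp [Fin.sum_univ_three]
      ring)
  have ha : ∀ j, eval ![0, 0, 0, 1] (a 0 j) = 0 := fun j => eval_eq_zero_of_syzygy (hsyz j) 0
  have hcoeffs : ∀ j, ∃ b d : MvPolynomial (Fin 4) K,
      (mulCommutator (X 3) ^ k) (η j).1 (X 1) = X 1 * b ∧
      (mulCommutator (X 3) ^ k) (η j).1 (X 0 + X 1 + X 2) = (X 0 + X 1 + X 2) * d ∧
        eval ![0, 0, 0, 1] (b - d) = 0 := by
    intro j
    refine exists_logarithmic_coeffs (leibniz_of_mem_diffOpsOfOrder_one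
      (mulCommutator_pow_mem_diffOpsOfOrder ?_)) (mulCommutator_pow_preserves k (η j).2.2)
    rw [add_comm]
    exact (η j).2.1
  choose b d hb hd hbd using hcoeffs
  have hcomm : ∀ p : MvPolynomial (Fin 4) K,
      (k.factorial : MvPolynomial (Fin 4) K) * (r * (X 1 * X 2) * (pderiv 1 p - pderiv 2 p)) =
        ∑ j, a 0 j * (mulCommutator (X 3) ^ k) (η j).1 p := by
    intro p
    have h0 := congrArg (fun θ => (mulCommutator (X 3) ^ k) θ.1 p) (hη 0)
    have h1 : (mulCommutator (X 3) ^ k) (pderivMulPow K 1 k) = _ :=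
      mulCommutator_pow_pderivMulPow (K := K) 1 k
    have h2 : (mulCommutator (X 3) ^ k) (pderivMulPow K 2 k) = _ :=
      mulCommutator_pow_pderivMulPow (K := K) 2 k
    simp [map_sum, h1, h2, LinearMap.sum_apply] at h0
    rw [← h0]
    ring
  have hone : (k.factorial : MvPolynomial (Fin 4) K) * (r * X 2) = ∑ j, a 0 j * b j := by
    refine mul_left_cancel₀ (X_ne_zero (R := K) (1 : Fin 4)) ?_
    have := hcomm (X 1)
    simp only [hb] at this
    rw [Finset.mul_sum]
    refine Eq.trans ?_ (this.trans (Finset.sum_congr rfl fun j _ => mul_left_comm _ _ _))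
    simp [pderiv_X]
    ring
  have hzero : 0 = ∑ j, a 0 j * d j := by
    have hne : (X 0 + X 1 + X 2 : MvPolynomial (Fin 4) K) ≠ 0 := by
      intro h
      simpa using congrArg (eval (Pi.single 0 1)) h
    refine mul_left_cancel₀ hne ?_
    have := hcomm (X 0 + X 1 + X 2)
    simp only [hd] at this
    rw [Finset.mul_sum]
    refine Eq.trans ?_ (this.trans (Finset.sum_congr rfl fun j _ => mul_left_comm _ _ _))
    simp [pderiv_X]
  have hfinal : (k.factorial : MvPolynomial (Fin 4) K) * (r * X 2) = ∑ j, a 0 j * (b j - d j) := by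
    simp only [mul_sub, Finset.sum_sub_distrib, ← hone, ← hzero, sub_zero]
  -- Both factors of each summand on the right vanish at the point, so its derivative does too; the
  -- left side gives `k!`, since `r` is 1 there.
  have := congrArg (fun p => eval ![0, 0, 0, 1] (pderiv 2 p)) hfinal
  simp only [map_sum, Derivation.leibniz, map_add, smul_eq_mul, map_mul, ha, hbd] at this
  simp [hrdef, pderiv_X, Nat.factorial_ne_zero] at this

end Example

/-- With coordinates `x = X 0`, `y = X 1`, `z = X 2`, `w = X 3`: the arrangement in `K ^ 4` with
defining polynomial `xyzw(x+y+z)(x+y+z+w)` exists, is irreducible, and is not `m`-free for any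
`m ≥ 1`. In particular, not every irreducible arrangement is `m`-free for all large `m`. -/
theorem proposition1p4 (K : Type*) [Field K] [CharZero K] :
    (∃ A : CentralArrangement K (Fin 4 → K),
      A.IsDefiningPolynomial
        (X 0 * X 1 * X 2 * X 3 * (X 0 + X 1 + X 2) * (X 0 + X 1 + X 2 + X 3))) ∧
    (∀ A : CentralArrangement K (Fin 4 → K),
      A.IsDefiningPolynomial
        (X 0 * X 1 * X 2 * X 3 * (X 0 + X 1 + X 2) * (X 0 + X 1 + X 2 + X 3)) →
      A.IsIrreducible ∧ ∀ m : ℕ, 1 ≤ m → ¬ A.IsMFree m) ∧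
    ¬ (∀ (ℓ : ℕ) (A : CentralArrangement K (Fin ℓ → K)), A.IsIrreducible →
      ∃ M : ℕ, ∀ m : ℕ, M ≤ m → A.IsMFree m) := by
  rw [← prod_linearFormPoly_form]
  have hexists := CentralArrangement.exists_of_injective_ker (form K) form_ne_zero
    form_ker_injective
  have hmain : ∀ A : CentralArrangement K (Fin 4 → K),
      A.IsDefiningPolynomial (∏ i, linearFormPoly (form K i)) →
      A.IsIrreducible ∧ ∀ m : ℕ, 1 ≤ m → ¬ A.IsMFree m := by
    intro A hA
    refine ⟨isIrreducible_of_ker_form_mem A fun i => hA.ker_mem (form_ne_zero i)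
      (Finset.dvd_prod_of_mem _ (Finset.mem_univ i)), fun m hm => ?_⟩
    obtain ⟨k, rfl⟩ := Nat.exists_eq_add_of_le' hm
    rw [CentralArrangement.IsMFree, CentralArrangement.diffOps_eq hA]
    exact not_free_diffOpsPreserving k
  refine ⟨hexists, hmain, fun h => ?_⟩
  obtain ⟨A, hA⟩ := hexists
  obtain ⟨M, hM⟩ := h 4 A (hmain A hA).1
  -- `M` itself may be 0, where non-freeness is not claimed.
  exact (hmain A hA).2 (M + 1) (Nat.le_add_left 1 M) (hM _ (Nat.le_succ M))
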